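/- Let $M$ be a compact Hausdorff smooth manifold without boundary of dimension $n\ge 1$, let $g$ be a smooth Riemannian metric on $M$, let $u\in C^\infty(M)$ be positive, and let $m>1$ be a real number. Put $p=2-m-n$ and consider the smooth metric measure space $(M^n,g,u^{p}\,\mathrm{dvol}_g)$ with dimensional parameter $p$. Suppose that it is quasi-Einstein with quasi-Einstein constant $\mu>0$, that is, $$\mathrm{Ric}_g-p\,u^{-1}\nabla^2u=\mu\, g ,$$ and that $\lambda\in\mathbb{R}$ is its characteristic constant, that is, $$R_g-2p\,u^{-1}\Delta u-p(p-1)\,u^{-2}|\nabla u|^2+p\,\lambda\,u^{-2}=(p+n)\,\mu ,$$ where $R_g$ is the scalar curvature and $\Delta$ is the trace of the Hessian $\nabla^2$. Then, at every point of $M$, $$|\nabla u|^2+\frac{\lambda}{m+n-1}<\frac{\mu}{m-1}\,u^2 .$$ -/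

import Mathlib

open scoped Manifold ContDiff

noncomputable section

/-- The model space `ℝⁿ`. -/
abbrev Model (n : ℕ) : Type := EuclideanSpace ℝ (Fin n)

/-! ### Riemannian geometry of a metric `G` given by its component matrix on (a part of) `ℝⁿ` -/

namespace Coord

variable {n : ℕ}

/-- The partial derivative `∂ᵢ f`. -/
def partialDeriv (i : Fin n) (f : Model n → ℝ) (y : Model n) : ℝ :=
  fderiv ℝ f y (EuclideanSpace.single i (1 : ℝ))

/-- The Christoffel symbol `Γᵏᵢⱼ = ½ Gᵏˡ (∂ᵢ Gⱼₗ + ∂ⱼ Gᵢₗ - ∂ₗ Gᵢⱼ)` of the Levi-Civita connection. -/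
def christoffel (G : Model n → Matrix (Fin n) (Fin n) ℝ) (k i j : Fin n) (y : Model n) : ℝ :=
  (1 / 2 : ℝ) * ∑ l, (G y)⁻¹ k l *
    (partialDeriv i (fun z => G z j l) y + partialDeriv j (fun z => G z i l) y
      - partialDeriv l (fun z => G z i j) y)

/-- The Ricci tensor
`Ricᵢⱼ = ∂ₖ Γᵏᵢⱼ - ∂ⱼ Γᵏₖᵢ + Γᵏₖₗ Γˡᵢⱼ - Γᵏⱼₗ Γˡᵢₖ` (positive on round spheres). -/
def ricci (G : Model n → Matrix (Fin n) (Fin n) ℝ) (i j : Fin n) (y : Model n) : ℝ :=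
  ∑ k, partialDeriv k (christoffel G k i j) y
    - ∑ k, partialDeriv j (christoffel G k k i) y
    + ∑ k, ∑ l, christoffel G k k l y * christoffel G l i j y
    - ∑ k, ∑ l, christoffel G k j l y * christoffel G l i k y

/-- The Hessian `(∇²f)ᵢⱼ = ∂ᵢ ∂ⱼ f - Γᵏᵢⱼ ∂ₖ f`. -/
def hessian (G : Model n → Matrix (Fin n) (Fin n) ℝ) (f : Model n → ℝ) (i j : Fin n)
    (y : Model n) : ℝ :=
  partialDeriv i (partialDeriv j f) y - ∑ k, christoffel G k i j y * partialDeriv k f y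

/-- The trace `Gⁱʲ Tᵢⱼ` at the point `y`. -/
def trace (G : Model n → Matrix (Fin n) (Fin n) ℝ) (T : Fin n → Fin n → ℝ) (y : Model n) : ℝ :=
  ∑ i, ∑ j, (G y)⁻¹ i j * T i j

/-- The scalar curvature `R = Gⁱʲ Ricᵢⱼ`. -/
def scalarCurvature (G : Model n → Matrix (Fin n) (Fin n) ℝ) (y : Model n) : ℝ :=
  trace G (fun i j => ricci G i j y) y

/-- The Laplacian `Δf = Gⁱʲ (∇²f)ᵢⱼ`. -/
def laplacian (G : Model n → Matrix (Fin n) (Fin n) ℝ) (f : Model n → ℝ) (y : Model n) : ℝ :=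
  trace G (fun i j => hessian G f i j y) y

end Coord

/-! ### Riemannian metrics on manifolds -/

section Manifold

variable {n : ℕ} {M : Type*} [TopologicalSpace M] [ChartedSpace (Model n) M]
  [IsManifold 𝓘(ℝ, Model n) ∞ M]

variable (n M) in
/-- Smooth Riemannian metrics on the `n`-dimensional manifold `M` (without boundary). -/
abbrev SmoothMetric : Type _ :=
  Bundle.ContMDiffRiemannianMetric 𝓘(ℝ, Model n) ∞ (Model n)
    (fun x : M => TangentSpace 𝓘(ℝ, Model n) x)

namespace SmoothMetric

/-- The component matrix `gᵢⱼ = g(∂ᵢ, ∂ⱼ)` of `g` in the chart `e`, as a function on `e.target`. -/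
def comp (g : SmoothMetric n M) (e : OpenPartialHomeomorph M (Model n)) (y : Model n) :
    Matrix (Fin n) (Fin n) ℝ :=
  Matrix.of fun i j => g.inner (e.symm y)
    (mfderiv 𝓘(ℝ, Model n) 𝓘(ℝ, Model n) e.symm y (EuclideanSpace.single i (1 : ℝ)))
    (mfderiv 𝓘(ℝ, Model n) 𝓘(ℝ, Model n) e.symm y (EuclideanSpace.single j (1 : ℝ)))

/-- Existence of the gradient: a positive definite form on a finite-dimensional tangent space
represents every covector. -/
theorem exists_gradient (g : SmoothMetric n M) (f : M → ℝ) (x : M) :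
    ∃ X : TangentSpace 𝓘(ℝ, Model n) x, ∀ Y : TangentSpace 𝓘(ℝ, Model n) x,
      g.inner x X Y = (mfderiv 𝓘(ℝ, Model n) 𝓘(ℝ, ℝ) f x : Model n →L[ℝ] ℝ) Y := by
  let B : Model n →L[ℝ] Model n →L[ℝ] ℝ := g.inner x
  let L : Model n →ₗ[ℝ] Module.Dual ℝ (Model n) :=
    (ContinuousLinearMap.coeLM ℝ).comp B.toLinearMap
  have hL : Function.Injective L := by
    rw [← LinearMap.ker_eq_bot, LinearMap.ker_eq_bot']
    intro v hv
    by_contra hne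
    have h1 : (0 : ℝ) < B v v := g.pos x v hne
    have h2 : L v v = 0 := by rw [hv]; rfl
    exact h1.ne' h2
  have hs : Function.Surjective L :=
    (LinearMap.injective_iff_surjective_of_finrank_eq_finrank
      (Subspace.dual_finrank_eq (K := ℝ) (V := Model n)).symm).1 hL
  obtain ⟨X, hX⟩ :=
    hs (mfderiv 𝓘(ℝ, Model n) 𝓘(ℝ, ℝ) f x : Model n →L[ℝ] ℝ).toLinearMap
  exact ⟨X, fun Y => LinearMap.congr_fun hX Y⟩

/-- The gradient `∇f`, the vector field with `g(∇f, Y) = df(Y)` for all `Y`. -/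
def gradient (g : SmoothMetric n M) (f : M → ℝ) (x : M) : TangentSpace 𝓘(ℝ, Model n) x :=
  (g.exists_gradient f x).choose

theorem inner_gradient (g : SmoothMetric n M) (f : M → ℝ) (x : M)
    (Y : TangentSpace 𝓘(ℝ, Model n) x) :
    g.inner x (g.gradient f x) Y = (mfderiv 𝓘(ℝ, Model n) 𝓘(ℝ, ℝ) f x : Model n →L[ℝ] ℝ) Y :=
  (g.exists_gradient f x).choose_spec Y

/-- `|∇f|²`. -/
def gradNormSq (g : SmoothMetric n M) (f : M → ℝ) (x : M) : ℝ :=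
  g.inner x (g.gradient f x) (g.gradient f x)

end SmoothMetric

/-! ### Smooth metric measure spaces -/

variable (n M) in
/-- A smooth metric measure space `(Mⁿ, g, vᵐ dvol_g, m)` with finite dimensional parameter `m`:
a Riemannian metric, a positive smooth function `v` and the parameter `m ∈ ℝ`. -/
structure SMMS where
  /-- the Riemannian metric `g` -/
  metric : SmoothMetric n M
  /-- the density `v`; the measure is `vᵐ dvol_g` -/
  v : M → ℝ
  smooth_v : ContMDiff 𝓘(ℝ, Model n) 𝓘(ℝ, ℝ) ∞ v
  pos_v : ∀ x, 0 < v x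
  /-- the dimensional parameter `m` -/
  dim : ℝ

namespace SMMS

/-- The components of the Bakry-Émery Ricci tensor `Ric - m v⁻¹ ∇²v` in the chart `e`. -/
def bakryEmeryRicci (S : SMMS n M) (e : OpenPartialHomeomorph M (Model n)) (i j : Fin n)
    (y : Model n) : ℝ :=
  Coord.ricci (S.metric.comp e) i j y
    - S.dim * (S.v (e.symm y))⁻¹ * Coord.hessian (S.metric.comp e) (S.v ∘ e.symm) i j y

/-- The weighted scalar curvature `R - 2 m v⁻¹ Δv - m (m - 1) v⁻² |∇v|²` at the point with
coordinates `y` in the chart `e`. With `vᵐ = e^{-φ}` and `m ≠ 0` this is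
`R + 2 Δφ - ((m + 1) / m) |∇φ|²`. -/
def weightedScalarCurvature (S : SMMS n M) (e : OpenPartialHomeomorph M (Model n))
    (y : Model n) : ℝ :=
  Coord.scalarCurvature (S.metric.comp e) y
    - 2 * S.dim * (S.v (e.symm y))⁻¹ * Coord.laplacian (S.metric.comp e) (S.v ∘ e.symm) y
    - S.dim * (S.dim - 1) * ((S.v (e.symm y))⁻¹) ^ 2 * S.metric.gradNormSq S.v (e.symm y)

/-- `S` is quasi-Einstein with quasi-Einstein constant `c`: the tensor equation
`Ric - m v⁻¹ ∇²v = c g` holds on `M`, i.e. in components in every smooth chart. -/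
def IsQuasiEinstein (S : SMMS n M) (c : ℝ) : Prop :=
  ∀ e ∈ IsManifold.maximalAtlas 𝓘(ℝ, Model n) ∞ M, ∀ y ∈ e.target, ∀ i j,
    S.bakryEmeryRicci e i j y = c * S.metric.comp e y i j

/-- `d` is the characteristic constant of the quasi-Einstein space `S` with quasi-Einstein
constant `c`: the weighted scalar curvature `R_φᵐ` satisfies `R_φᵐ + m d v⁻² = (m + n) c`. -/
def IsCharacteristicConstant (S : SMMS n M) (c d : ℝ) : Prop :=
  ∀ e ∈ IsManifold.maximalAtlas 𝓘(ℝ, Model n) ∞ M, ∀ y ∈ e.target,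
    S.weightedScalarCurvature e y + S.dim * d * ((S.v (e.symm y))⁻¹) ^ 2 = (S.dim + n) * c

end SMMS

end Manifold

end

/-!
Write `p = 2 - m - n`, `N = m + n - 1 = 1 - p`, `a = lam / N`, `c = mu / (m - 1)` and `w = |∇u|²`.
The trace of the quasi-Einstein equation and the definition of the characteristic constant combine
to `u Δu = N (w + a) - mu u²` (`SMMS.IsQuasiEinstein.mul_laplacian`). The assertion is that
`F = (w + a) / u²` is less than `c` everywhere, and it follows from the maximum principle.

At a critical point of `F`, the Bochner formula (`Coord.IsMetricAt.bochner`), with the Ricci tensor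
and `Δu` replaced through these equations, gives `½ ΔF = u⁻² |∇²u|² - F (N F - mu)`. Since
`n |∇²u|² ≥ (Δu)² = u² (N F - mu)²`, a maximum of `F` satisfies
`(N F - mu) ((m - 1) F - mu) ≤ 0`, hence `F ≤ c`. For the strict inequality one would invoke the
strong maximum principle; instead, `F + ε uᵏ` is maximised. Where `F` is close to `c`, the function
`u` is strictly subharmonic, because `N c - mu = n c > 0`, so for large `k` and small `ε` the
perturbation contributes a strictly positive term to the Laplacian, and a value of `F` that reaches
`c` is contradictory (`false_of_perturbed_max`).

The conditions at the maximum, of value `h`, are applied to `w + a + ε uᵏ⁺² - h u²`, which has a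
local maximum at the same point and involves no quotient
(`Coord.IsMetricAt.laplacian_sq_le_of_isLocalMax`).

The Bochner formula is proved in an arbitrary chart, in matrix notation: for the connection
matrices `Γₐ` with entries `Γᵏₐⱼ`, metric compatibility reads `∂ₐG = G Γₐ + Γₐᵀ G`, the curvature is
`∂ᵢΓ_b - ∂_bΓᵢ + [Γᵢ, Γ_b]`, and its antisymmetry with respect to `G` is the equality of mixed
second derivatives of `G`.
-/

/-! ### Partial derivatives of vector- and matrix-valued maps -/

namespace Coord

open Matrix Filter Topology

variable {n : ℕ}

theorem partialDeriv_congr {f g : Model n → ℝ} {y : Model n} (h : f =ᶠ[𝓝 y] g) (i : Fin n) :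
    partialDeriv i f y = partialDeriv i g y := by
  unfold partialDeriv; rw [h.fderiv_eq]

theorem _root_.ContDiffAt.partialDeriv {f : Model n → ℝ} {y : Model n} (h : ContDiffAt ℝ ∞ f y)
    (i : Fin n) : ContDiffAt ℝ ∞ (Coord.partialDeriv i f) y :=
  (h.fderiv_right (m := ∞) (by simp)).clm_apply contDiffAt_const

theorem partialDeriv_add {f g : Model n → ℝ} {y : Model n} (hf : ContDiffAt ℝ ∞ f y)
    (hg : ContDiffAt ℝ ∞ g y) (i : Fin n) :
    partialDeriv i (fun z => f z + g z) y = partialDeriv i f y + partialDeriv i g y := by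
  unfold partialDeriv
  rw [fderiv_fun_add (hf.differentiableAt (by simp)) (hg.differentiableAt (by simp))]; rfl

theorem partialDeriv_sub {f g : Model n → ℝ} {y : Model n} (hf : ContDiffAt ℝ ∞ f y)
    (hg : ContDiffAt ℝ ∞ g y) (i : Fin n) :
    partialDeriv i (fun z => f z - g z) y = partialDeriv i f y - partialDeriv i g y := by
  unfold partialDeriv
  rw [fderiv_fun_sub (hf.differentiableAt (by simp)) (hg.differentiableAt (by simp))]; rfl

theorem partialDeriv_mul {f g : Model n → ℝ} {y : Model n} (hf : ContDiffAt ℝ ∞ f y)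
    (hg : ContDiffAt ℝ ∞ g y) (i : Fin n) :
    partialDeriv i (fun z => f z * g z) y
      = partialDeriv i f y * g y + f y * partialDeriv i g y := by
  unfold partialDeriv
  rw [fderiv_fun_mul (hf.differentiableAt (by simp)) (hg.differentiableAt (by simp))]
  simp; ring

theorem partialDeriv_sum {ι : Type*} {s : Finset ι} {f : ι → Model n → ℝ} {y : Model n}
    (hf : ∀ k ∈ s, ContDiffAt ℝ ∞ (f k) y) (i : Fin n) :
    partialDeriv i (fun z => ∑ k ∈ s, f k z) y = ∑ k ∈ s, partialDeriv i (f k) y := by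
  unfold partialDeriv
  rw [fderiv_fun_sum fun k hk => (hf k hk).differentiableAt (by simp)]
  simp

theorem partialDeriv_const (c : ℝ) (i : Fin n) (y : Model n) :
    partialDeriv i (fun _ => c) y = 0 := by
  simp [partialDeriv]

theorem partialDeriv_comp {f : Model n → ℝ} {y : Model n} (hf : ContDiffAt ℝ ∞ f y)
    {ψ : ℝ → ℝ} (hψ : DifferentiableAt ℝ ψ (f y)) (i : Fin n) :
    partialDeriv i (fun z => ψ (f z)) y = deriv ψ (f y) * partialDeriv i f y := by
  unfold partialDeriv
  have := (hψ.hasDerivAt.comp_hasFDerivAt y (hf.differentiableAt (by simp)).hasFDerivAt).fderiv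
  rw [show (fun z => ψ (f z)) = ψ ∘ f from rfl, this]; simp

theorem partialDeriv_comm {f : Model n → ℝ} {y : Model n} (hf : ContDiffAt ℝ ∞ f y)
    (i j : Fin n) :
    partialDeriv i (partialDeriv j f) y = partialDeriv j (partialDeriv i f) y := by
  have hd : DifferentiableAt ℝ (fderiv ℝ f) y :=
    (hf.fderiv_right (m := ∞) (by simp)).differentiableAt (by simp)
  have key : ∀ a b : Fin n, partialDeriv a (partialDeriv b f) y
      = fderiv ℝ (fderiv ℝ f) y (EuclideanSpace.single a 1) (EuclideanSpace.single b 1) := by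
    intro a b
    unfold partialDeriv
    rw [fderiv_clm_apply hd (differentiableAt_const _)]
    simp
  rw [key, key]
  exact (hf.isSymmSndFDerivAt (by
    simpa using WithTop.coe_le_coe.2 (le_top : (2 : ℕ∞) ≤ ⊤))) _ _

/-- A vector-valued map all of whose components are smooth at `y`. -/
noncomputable def SmoothVec (X : Model n → Fin n → ℝ) (y : Model n) : Prop :=
  ∀ i, ContDiffAt ℝ ∞ (fun z => X z i) y

/-- A matrix-valued map all of whose entries are smooth at `y`. -/
noncomputable def SmoothMat (F : Model n → Matrix (Fin n) (Fin n) ℝ) (y : Model n) : Prop :=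
  ∀ i j, ContDiffAt ℝ ∞ (fun z => F z i j) y

/-- The componentwise partial derivative `∂ₐ X` of a vector-valued map. -/
noncomputable def vecDeriv (a : Fin n) (X : Model n → Fin n → ℝ) (y : Model n) : Fin n → ℝ :=
  fun i => partialDeriv a (fun z => X z i) y

/-- The entrywise partial derivative `∂ₐ F` of a matrix-valued map. -/
noncomputable def matDeriv (a : Fin n) (F : Model n → Matrix (Fin n) (Fin n) ℝ) (y : Model n) :
    Matrix (Fin n) (Fin n) ℝ :=
  of fun i j => partialDeriv a (fun z => F z i j) y

section Leibniz

variable {F K : Model n → Matrix (Fin n) (Fin n) ℝ} {X Z : Model n → Fin n → ℝ} {y : Model n}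

theorem matDeriv_congr (h : F =ᶠ[𝓝 y] K) (a : Fin n) : matDeriv a F y = matDeriv a K y := by
  ext i j
  exact partialDeriv_congr (h.mono fun z hz => by simp only [hz]) a

theorem vecDeriv_congr (h : X =ᶠ[𝓝 y] Z) (a : Fin n) : vecDeriv a X y = vecDeriv a Z y := by
  ext i
  exact partialDeriv_congr (h.mono fun z hz => by simp only [hz]) a

theorem SmoothMat.mul (hF : SmoothMat F y) (hK : SmoothMat K y) :
    SmoothMat (fun z => F z * K z) y := fun i j => by
  simp only [mul_apply]
  exact ContDiffAt.sum fun k _ => (hF i k).mul (hK k j)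

theorem SmoothMat.transpose (hF : SmoothMat F y) : SmoothMat (fun z => (F z)ᵀ) y :=
  fun i j => hF j i

theorem SmoothMat.mulVec (hF : SmoothMat F y) (hX : SmoothVec X y) :
    SmoothVec (fun z => F z *ᵥ X z) y := fun i => by
  simp only [Matrix.mulVec, dotProduct]
  exact ContDiffAt.sum fun k _ => (hF i k).mul (hX k)

theorem SmoothVec.vecMul (hX : SmoothVec X y) (hF : SmoothMat F y) :
    SmoothVec (fun z => X z ᵥ* F z) y := fun i => by
  simp only [Matrix.vecMul, dotProduct]
  exact ContDiffAt.sum fun k _ => (hX k).mul (hF k i)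

theorem SmoothVec.vecDeriv (hX : SmoothVec X y) (a : Fin n) : SmoothVec (vecDeriv a X) y :=
  fun i => (hX i).partialDeriv a

theorem matDeriv_mul (hF : SmoothMat F y) (hK : SmoothMat K y) (a : Fin n) :
    matDeriv a (fun z => F z * K z) y = matDeriv a F y * K y + F y * matDeriv a K y := by
  ext i j
  simp only [matDeriv, mul_apply, of_apply, Matrix.add_apply]
  rw [partialDeriv_sum fun k _ => (hF i k).mul (hK k j), ← Finset.sum_add_distrib]
  exact Finset.sum_congr rfl fun k _ => partialDeriv_mul (hF i k) (hK k j) a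

theorem matDeriv_add (hF : SmoothMat F y) (hK : SmoothMat K y) (a : Fin n) :
    matDeriv a (fun z => F z + K z) y = matDeriv a F y + matDeriv a K y := by
  ext i j
  exact partialDeriv_add (hF i j) (hK i j) a

theorem matDeriv_transpose (a : Fin n) :
    matDeriv a (fun z => (F z)ᵀ) y = (matDeriv a F y)ᵀ := rfl

theorem matDeriv_comm (hF : SmoothMat F y) (a b : Fin n) :
    matDeriv a (matDeriv b F) y = matDeriv b (matDeriv a F) y := by
  ext i j
  exact partialDeriv_comm (hF i j) a b

theorem vecDeriv_mulVec (hF : SmoothMat F y) (hX : SmoothVec X y) (a : Fin n) :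
    vecDeriv a (fun z => F z *ᵥ X z) y = matDeriv a F y *ᵥ X y + F y *ᵥ vecDeriv a X y := by
  ext i
  simp only [vecDeriv, matDeriv, Matrix.mulVec, dotProduct, of_apply, Pi.add_apply]
  rw [partialDeriv_sum fun k _ => (hF i k).mul (hX k), ← Finset.sum_add_distrib]
  exact Finset.sum_congr rfl fun k _ => partialDeriv_mul (hF i k) (hX k) a

theorem vecDeriv_vecMul (hX : SmoothVec X y) (hF : SmoothMat F y) (a : Fin n) :
    vecDeriv a (fun z => X z ᵥ* F z) y = vecDeriv a X y ᵥ* F y + X y ᵥ* matDeriv a F y := by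
  ext i
  simp only [vecDeriv, matDeriv, Matrix.vecMul, dotProduct, of_apply, Pi.add_apply]
  rw [partialDeriv_sum fun k _ => (hX k).mul (hF k i), ← Finset.sum_add_distrib]
  exact Finset.sum_congr rfl fun k _ => partialDeriv_mul (hX k) (hF k i) a

theorem vecDeriv_sub (hX : SmoothVec X y) (hZ : SmoothVec Z y) (a : Fin n) :
    vecDeriv a (fun z => X z - Z z) y = vecDeriv a X y - vecDeriv a Z y := by
  ext i
  exact partialDeriv_sub (hX i) (hZ i) a

theorem vecDeriv_smul (c : ℝ) (hX : SmoothVec X y) (a : Fin n) :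
    vecDeriv a (fun z => c • X z) y = c • vecDeriv a X y := by
  ext i
  change partialDeriv a (fun z => c * X z i) y = _
  rw [partialDeriv_mul contDiffAt_const (hX i), partialDeriv_const]
  simp [vecDeriv]

theorem partialDeriv_dotProduct (hX : SmoothVec X y) (hZ : SmoothVec Z y) (a : Fin n) :
    partialDeriv a (fun z => X z ⬝ᵥ Z z) y = vecDeriv a X y ⬝ᵥ Z y + X y ⬝ᵥ vecDeriv a Z y := by
  simp only [dotProduct, vecDeriv]
  rw [partialDeriv_sum fun k _ => (hX k).mul (hZ k), ← Finset.sum_add_distrib]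
  exact Finset.sum_congr rfl fun k _ => partialDeriv_mul (hX k) (hZ k) a

theorem partialDeriv_trace (hF : SmoothMat F y) (a : Fin n) :
    partialDeriv a (fun z => (F z).trace) y = (matDeriv a F y).trace := by
  simp only [Matrix.trace, matDeriv]
  exact partialDeriv_sum (fun k _ => hF k k) a

theorem SmoothMat.det (hF : SmoothMat F y) : ContDiffAt ℝ ∞ (fun z => (F z).det) y := by
  simp only [det_apply']
  exact ContDiffAt.sum fun σ _ => contDiffAt_const.mul (contDiffAt_prod fun k _ => hF _ _)

theorem SmoothMat.inv (hF : SmoothMat F y) (hdet : (F y).det ≠ 0) :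
    SmoothMat (fun z => (F z)⁻¹) y := by
  intro i j
  simp only [inv_def, Ring.inverse_eq_inv', Matrix.smul_apply, smul_eq_mul, adjugate_apply]
  refine (hF.det.inv hdet).mul (SmoothMat.det fun k l => ?_)
  by_cases hk : k = j
  · subst hk; simpa using contDiffAt_const
  · simpa [hk] using hF k l

end Leibniz

end Coord

/-! ### The Levi-Civita connection in matrix form -/

namespace Coord

open Matrix Filter Topology

variable {n : ℕ}

/-- The connection matrix `Γₐ` of the Levi-Civita connection, with entries `(Γₐ)ᵏⱼ = Γᵏₐⱼ`. -/
noncomputable def connMat (G : Model n → Matrix (Fin n) (Fin n) ℝ) (a : Fin n) (z : Model n) :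
    Matrix (Fin n) (Fin n) ℝ :=
  of fun k j => christoffel G k a j z

/-- The curvature matrix `∂ᵢ Γ_b - ∂_b Γᵢ + Γᵢ Γ_b - Γ_b Γᵢ` of the Levi-Civita connection. -/
noncomputable def curvMat (G : Model n → Matrix (Fin n) (Fin n) ℝ) (i b : Fin n) (z : Model n) :
    Matrix (Fin n) (Fin n) ℝ :=
  matDeriv i (connMat G b) z - matDeriv b (connMat G i) z
    + connMat G i z * connMat G b z - connMat G b z * connMat G i z

/-- The Hessian `∇²f` as a matrix. -/
noncomputable def hessMat (G : Model n → Matrix (Fin n) (Fin n) ℝ) (f : Model n → ℝ) (z : Model n) :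
    Matrix (Fin n) (Fin n) ℝ :=
  of fun i j => hessian G f i j z

/-- The covector of partial derivatives of `f`. -/
noncomputable def diff (f : Model n → ℝ) (z : Model n) : Fin n → ℝ := fun i => partialDeriv i f z

/-- The components `(∇f)ⁱ = Gⁱʲ ∂ⱼ f` of the gradient. -/
noncomputable def grad (G : Model n → Matrix (Fin n) (Fin n) ℝ) (f : Model n → ℝ) (z : Model n) :
    Fin n → ℝ :=
  (G z)⁻¹ *ᵥ diff f z

/-- `|∇f|²` in coordinates. -/
noncomputable def normSqGrad (G : Model n → Matrix (Fin n) (Fin n) ℝ) (f : Model n → ℝ)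
    (z : Model n) : ℝ :=
  diff f z ⬝ᵥ grad G f z

/-- `G` is the component matrix of a smooth Riemannian metric near `y`. Smoothness is required at
all nearby points: `ContDiffAt ℝ ∞` at `y` alone does not give a common neighbourhood for the
derivatives of all orders. -/
structure IsMetricAt (G : Model n → Matrix (Fin n) (Fin n) ℝ) (y : Model n) : Prop where
  smooth : ∀ᶠ z in 𝓝 y, SmoothMat G z
  posDef : ∀ᶠ z in 𝓝 y, (G z).PosDef

variable {G : Model n → Matrix (Fin n) (Fin n) ℝ} {f : Model n → ℝ} {y : Model n}

theorem IsMetricAt.eventually (h : IsMetricAt G y) : ∀ᶠ z in 𝓝 y, IsMetricAt G z := by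
  filter_upwards [h.smooth.eventually_nhds, h.posDef.eventually_nhds] with z h1 h2
  exact ⟨h1, h2⟩

theorem _root_.ContDiffAt.smoothVec_diff (hf : ContDiffAt ℝ ∞ f y) : SmoothVec (diff f) y :=
  fun i => hf.partialDeriv i

namespace IsMetricAt

variable (h : IsMetricAt G y)
include h

theorem smoothMat : SmoothMat G y := h.smooth.self_of_nhds

theorem isUnit_det : IsUnit (G y).det := h.posDef.self_of_nhds.det_pos.ne'.isUnit

theorem transpose_eq : (G y)ᵀ = G y := by
  simpa only [conjTranspose_eq_transpose_of_trivial] using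
    h.posDef.self_of_nhds.isHermitian.eq

theorem apply_comm (i j : Fin n) : G y i j = G y j i := by
  conv_lhs => rw [← h.transpose_eq]
  rfl

theorem inv_transpose : ((G y)⁻¹)ᵀ = (G y)⁻¹ := by
  rw [transpose_nonsing_inv, h.transpose_eq]

theorem smoothMat_inv : SmoothMat (fun z => (G z)⁻¹) y :=
  h.smoothMat.inv h.posDef.self_of_nhds.det_pos.ne'

theorem partialDeriv_apply_comm (a i j : Fin n) :
    partialDeriv a (fun z => G z i j) y = partialDeriv a (fun z => G z j i) y :=
  partialDeriv_congr (h.eventually.mono fun _ hz => hz.apply_comm i j) a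

theorem christoffel_comm (k i j : Fin n) : christoffel G k i j y = christoffel G k j i y := by
  unfold christoffel
  congr 1
  refine Finset.sum_congr rfl fun l _ => ?_
  rw [h.partialDeriv_apply_comm l i j, add_comm (partialDeriv i _ y)]

theorem smooth_christoffel (k i j : Fin n) : ContDiffAt ℝ ∞ (christoffel G k i j) y :=
  contDiffAt_const.mul (ContDiffAt.sum fun l _ => (h.smoothMat_inv k l).mul
    ((((h.smoothMat j l).partialDeriv i).add ((h.smoothMat i l).partialDeriv j)).sub
      ((h.smoothMat i j).partialDeriv l)))

theorem smoothMat_connMat (a : Fin n) : SmoothMat (connMat G a) y :=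
  fun k j => h.smooth_christoffel k a j

theorem partialDeriv_christoffel_comm (a k i j : Fin n) :
    partialDeriv a (christoffel G k i j) y = partialDeriv a (christoffel G k j i) y :=
  partialDeriv_congr (h.eventually.mono fun _ hz => hz.christoffel_comm k i j) a

/-- Lowering the upper index of the Christoffel symbols. -/
theorem mul_connMat (a : Fin n) : G y * connMat G a y = of fun l j => (1 / 2 : ℝ) *
    (partialDeriv a (fun z => G z j l) y + partialDeriv j (fun z => G z a l) y
      - partialDeriv l (fun z => G z a j) y) := by
  have : connMat G a y = (G y)⁻¹ * of fun l j => (1 / 2 : ℝ) *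
      (partialDeriv a (fun z => G z j l) y + partialDeriv j (fun z => G z a l) y
        - partialDeriv l (fun z => G z a j) y) := by
    ext k j
    simp only [connMat, christoffel, of_apply, mul_apply, Finset.mul_sum]
    exact Finset.sum_congr rfl fun l _ => by ring
  rw [this, mul_nonsing_inv_cancel_left _ _ h.isUnit_det]

/-- Metric compatibility of the Levi-Civita connection. -/
theorem matDeriv_metric (a : Fin n) :
    matDeriv a G y = G y * connMat G a y + (connMat G a y)ᵀ * G y := by
  have : (connMat G a y)ᵀ * G y = (G y * connMat G a y)ᵀ := by
    rw [transpose_mul, h.transpose_eq]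
  rw [this, h.mul_connMat]
  ext i j
  simp only [matDeriv, of_apply, Matrix.add_apply, transpose_apply]
  rw [h.partialDeriv_apply_comm a j i]
  ring

theorem matDeriv_inv (a : Fin n) : matDeriv a (fun z => (G z)⁻¹) y
    = -(connMat G a y * (G y)⁻¹) - (G y)⁻¹ * (connMat G a y)ᵀ := by
  have h1 : matDeriv a (fun z => (G z)⁻¹ * G z) y = 0 := by
    rw [matDeriv_congr (K := fun _ => 1)
      (h.eventually.mono fun _ hz => nonsing_inv_mul _ hz.isUnit_det)]
    ext i j
    exact partialDeriv_const _ _ _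
  rw [matDeriv_mul h.smoothMat_inv h.smoothMat, h.matDeriv_metric] at h1
  have h2 : matDeriv a (fun z => (G z)⁻¹) y * G y * (G y)⁻¹
      = -((G y)⁻¹ * (G y * connMat G a y + (connMat G a y)ᵀ * G y)) * (G y)⁻¹ := by
    rw [eq_neg_of_add_eq_zero_left h1]
  rw [mul_nonsing_inv_cancel_right _ _ h.isUnit_det, Matrix.mul_add, ← Matrix.mul_assoc,
    nonsing_inv_mul _ h.isUnit_det, ← Matrix.mul_assoc, Matrix.neg_mul, Matrix.add_mul,
    mul_nonsing_inv_cancel_right _ _ h.isUnit_det] at h2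
  rw [h2, Matrix.one_mul]
  abel

/-- The curvature of a metric connection takes values in the antisymmetric endomorphisms; this is
the commutation `∂ᵢ ∂_b G = ∂_b ∂ᵢ G` of partial derivatives. -/
theorem mul_curvMat_antisymm (i b : Fin n) :
    G y * curvMat G i b y + (curvMat G i b y)ᵀ * G y = 0 := by
  have key : ∀ a c : Fin n, matDeriv a (matDeriv c G) y
      = (G y * connMat G a y + (connMat G a y)ᵀ * G y) * connMat G c y
        + G y * matDeriv a (connMat G c) y
        + ((matDeriv a (connMat G c) y)ᵀ * G y
        + (connMat G c y)ᵀ * (G y * connMat G a y + (connMat G a y)ᵀ * G y)) := by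
    intro a c
    rw [matDeriv_congr (h.eventually.mono fun _ hz => hz.matDeriv_metric c),
      matDeriv_add (h.smoothMat.mul (h.smoothMat_connMat c))
        ((h.smoothMat_connMat c).transpose.mul h.smoothMat),
      matDeriv_mul h.smoothMat (h.smoothMat_connMat c),
      matDeriv_mul (h.smoothMat_connMat c).transpose h.smoothMat, matDeriv_transpose,
      h.matDeriv_metric]
  have hc := matDeriv_comm h.smoothMat i b
  rw [key, key, ← sub_eq_zero] at hc
  rw [← hc]
  simp only [curvMat, transpose_add, transpose_sub, transpose_mul]
  noncomm_ring

theorem curvMat_mul_inv_antisymm (i b : Fin n) :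
    (curvMat G i b y * (G y)⁻¹)ᵀ = -(curvMat G i b y * (G y)⁻¹) := by
  have h1 := eq_neg_of_add_eq_zero_right (h.mul_curvMat_antisymm i b)
  have h2 : (G y)⁻¹ * ((curvMat G i b y)ᵀ * G y) * (G y)⁻¹
      = (G y)⁻¹ * (-(G y * curvMat G i b y)) * (G y)⁻¹ := by rw [h1]
  rw [← Matrix.mul_assoc, mul_nonsing_inv_cancel_right _ _ h.isUnit_det, Matrix.mul_neg,
    ← Matrix.mul_assoc, nonsing_inv_mul _ h.isUnit_det, Matrix.one_mul, Matrix.neg_mul] at h2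
  rw [transpose_mul, h.inv_transpose, h2]

omit h in
theorem curvMat_swap (i b : Fin n) : curvMat G i b y = -curvMat G b i y := by
  simp only [curvMat]; abel

/-- The Ricci tensor is the trace of the curvature. -/
theorem ricci_eq_sum_curvMat (a b : Fin n) : ricci G a b y = ∑ k, curvMat G k b y k a := by
  simp only [ricci, curvMat, Matrix.add_apply, Matrix.sub_apply, Finset.sum_add_distrib,
    Finset.sum_sub_distrib, matDeriv, connMat, of_apply, mul_apply]
  congr 1
  · congr 1
    · congr 1
      exact Finset.sum_congr rfl fun k _ => h.partialDeriv_christoffel_comm k k a b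
    · exact Finset.sum_congr rfl fun k _ => Finset.sum_congr rfl fun l _ => by
        rw [h.christoffel_comm l a b]
  · exact Finset.sum_congr rfl fun k _ => Finset.sum_congr rfl fun l _ => by
        rw [h.christoffel_comm l a k]

theorem smoothVec_grad (hf : ContDiffAt ℝ ∞ f y) : SmoothVec (grad G f) y :=
  h.smoothMat_inv.mulVec hf.smoothVec_diff

theorem hessian_comm (hf : ContDiffAt ℝ ∞ f y) (i j : Fin n) :
    hessian G f i j y = hessian G f j i y := by
  unfold hessian
  rw [partialDeriv_comm hf]
  simp only [h.christoffel_comm _ i j]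

theorem smoothMat_hessMat (hf : ContDiffAt ℝ ∞ f y) : SmoothMat (hessMat G f) y := fun i j =>
  ((hf.partialDeriv j).partialDeriv i).sub
    (ContDiffAt.sum fun k _ => (h.smooth_christoffel k i j).mul (hf.partialDeriv k))

theorem hessMat_transpose (hf : ContDiffAt ℝ ∞ f y) : (hessMat G f y)ᵀ = hessMat G f y := by
  ext i j
  exact h.hessian_comm hf j i

omit h in
/-- The `b`-th row of the Hessian is the covariant derivative `∇_b df`. -/
theorem hessMat_row (f : Model n → ℝ) (b : Fin n) (z : Model n) :
    hessMat G f z b = vecDeriv b (diff f) z - diff f z ᵥ* connMat G b z := by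
  ext i
  simp only [hessMat, hessian, of_apply, vecDeriv, diff, Pi.sub_apply, vecMul, dotProduct, connMat]
  congr 1
  exact Finset.sum_congr rfl fun k _ => mul_comm _ _

/-- The covariant derivative of the gradient is the Hessian with one index raised. -/
theorem vecDeriv_grad (hf : ContDiffAt ℝ ∞ f y) (b : Fin n) : vecDeriv b (grad G f) y
    = (G y)⁻¹ *ᵥ hessMat G f y b - connMat G b y *ᵥ grad G f y := by
  unfold grad
  rw [vecDeriv_mulVec h.smoothMat_inv hf.smoothVec_diff, h.matDeriv_inv, hessMat_row,
    mulVec_sub, sub_mulVec, neg_mulVec, mulVec_mulVec, ← mulVec_mulVec _ (G y)⁻¹,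
    mulVec_transpose]
  abel

theorem smooth_normSqGrad (hf : ContDiffAt ℝ ∞ f y) : ContDiffAt ℝ ∞ (normSqGrad G f) y := by
  unfold normSqGrad
  simp only [dotProduct]
  exact ContDiffAt.sum fun k _ => (hf.partialDeriv k).mul (h.smoothVec_grad hf k)

theorem dotProduct_inv_mulVec (x z : Fin n → ℝ) :
    x ⬝ᵥ ((G y)⁻¹ *ᵥ z) = z ⬝ᵥ ((G y)⁻¹ *ᵥ x) := by
  rw [dotProduct_mulVec, ← mulVec_transpose, h.inv_transpose, dotProduct_comm]

/-- `d|∇f|² = 2 ∇²f(∇f, ·)`. -/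
theorem diff_normSqGrad (hf : ContDiffAt ℝ ∞ f y) :
    diff (normSqGrad G f) y = (2 : ℝ) • (hessMat G f y *ᵥ grad G f y) := by
  ext b
  have h1 : partialDeriv b (normSqGrad G f) y = vecDeriv b (diff f) y ⬝ᵥ grad G f y
      + diff f y ⬝ᵥ vecDeriv b (grad G f) y :=
    partialDeriv_dotProduct hf.smoothVec_diff (h.smoothVec_grad hf) b
  have h2 : vecDeriv b (diff f) y = hessMat G f y b + diff f y ᵥ* connMat G b y := by
    rw [hessMat_row]; abel
  have h3 : diff f y ⬝ᵥ ((G y)⁻¹ *ᵥ hessMat G f y b) = hessMat G f y b ⬝ᵥ grad G f y :=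
    h.dotProduct_inv_mulVec _ _
  rw [diff, h1, h.vecDeriv_grad hf, h2, dotProduct_sub, h3, add_dotProduct,
    dotProduct_mulVec]
  simp only [Pi.smul_apply, smul_eq_mul, mulVec]
  ring

end IsMetricAt

end Coord

/-! ### The Bochner formula -/

namespace Coord

open Matrix Filter Topology

variable {n : ℕ}

/-- The covariant derivative `∇_b ∇²f` of the Hessian, as a matrix. -/
noncomputable def covDerivHess (G : Model n → Matrix (Fin n) (Fin n) ℝ) (f : Model n → ℝ)
    (b : Fin n) (z : Model n) : Matrix (Fin n) (Fin n) ℝ :=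
  matDeriv b (hessMat G f) z - hessMat G f z * connMat G b z
    - (connMat G b z)ᵀ * hessMat G f z

variable {G : Model n → Matrix (Fin n) (Fin n) ℝ} {f : Model n → ℝ} {y : Model n}

namespace IsMetricAt

variable (h : IsMetricAt G y) (hf : ∀ᶠ z in 𝓝 y, ContDiffAt ℝ ∞ f z)
include h hf

theorem covDerivHess_transpose (b : Fin n) :
    (covDerivHess G f b y)ᵀ = covDerivHess G f b y := by
  have h1 : (matDeriv b (hessMat G f) y)ᵀ = matDeriv b (hessMat G f) y := by
    rw [← matDeriv_transpose]
    refine matDeriv_congr ?_ b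
    filter_upwards [h.eventually, hf] with z hz hfz using hz.hessMat_transpose hfz
  unfold covDerivHess
  rw [transpose_sub, transpose_sub, transpose_mul, transpose_mul, transpose_transpose, h1,
    h.hessMat_transpose hf.self_of_nhds]
  abel

/-- The Ricci identity for the commutator of second covariant derivatives of `df`. -/
theorem covDerivHess_sub_covDerivHess (i b : Fin n) :
    covDerivHess G f b y i - covDerivHess G f i y b = diff f y ᵥ* curvMat G i b y := by
  have hf0 := hf.self_of_nhds
  have key : ∀ c d : Fin n, covDerivHess G f c y d
      = (vecDeriv c (vecDeriv d (diff f)) y - (vecDeriv c (diff f) y ᵥ* connMat G d y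
          + diff f y ᵥ* matDeriv c (connMat G d) y))
        - (vecDeriv d (diff f) y - diff f y ᵥ* connMat G d y) ᵥ* connMat G c y
        - ((connMat G c y)ᵀ * hessMat G f y) d := by
    intro c d
    have e1 : matDeriv c (hessMat G f) y d = vecDeriv c (fun z => hessMat G f z d) y := rfl
    have e2 : vecDeriv c (fun z => hessMat G f z d) y = vecDeriv c (vecDeriv d (diff f)) y
        - (vecDeriv c (diff f) y ᵥ* connMat G d y
          + diff f y ᵥ* matDeriv c (connMat G d) y) := by
      simp only [hessMat_row]
      rw [vecDeriv_sub (hf0.smoothVec_diff.vecDeriv d)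
        (hf0.smoothVec_diff.vecMul (h.smoothMat_connMat d)),
        vecDeriv_vecMul hf0.smoothVec_diff (h.smoothMat_connMat d)]
    have e3 : (hessMat G f y * connMat G c y) d = hessMat G f y d ᵥ* connMat G c y := rfl
    have e4 : covDerivHess G f c y d = matDeriv c (hessMat G f) y d
        - (hessMat G f y * connMat G c y) d - ((connMat G c y)ᵀ * hessMat G f y) d := rfl
    rw [e4, e1, e2, e3, hessMat_row]
  have hsymm : ((connMat G b y)ᵀ * hessMat G f y) i = ((connMat G i y)ᵀ * hessMat G f y) b := by
    ext a
    simp only [mul_apply, transpose_apply, connMat, of_apply]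
    exact Finset.sum_congr rfl fun l _ => by rw [h.christoffel_comm l b i]
  have hcomm : vecDeriv b (vecDeriv i (diff f)) y = vecDeriv i (vecDeriv b (diff f)) y := by
    ext k
    exact partialDeriv_comm (hf0.partialDeriv k) b i
  rw [key b i, key i b, hsymm, hcomm, curvMat, vecMul_sub, vecMul_add, vecMul_sub, sub_vecMul,
    sub_vecMul, vecMul_vecMul, vecMul_vecMul]
  abel

/-- The Hessian of `|∇f|²`. -/
theorem hessMat_normSqGrad_row (b : Fin n) : hessMat G (normSqGrad G f) y b
    = (2 : ℝ) • (covDerivHess G f b y *ᵥ grad G f y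
      + hessMat G f y *ᵥ ((G y)⁻¹ *ᵥ hessMat G f y b)) := by
  have hf0 := hf.self_of_nhds
  have e : vecDeriv b (diff (normSqGrad G f)) y
      = (2 : ℝ) • vecDeriv b (fun z => hessMat G f z *ᵥ grad G f z) y := by
    rw [← vecDeriv_smul _ ((h.smoothMat_hessMat hf0).mulVec (h.smoothVec_grad hf0))]
    refine vecDeriv_congr ?_ b
    filter_upwards [h.eventually, hf] with z hz hfz using hz.diff_normSqGrad hfz
  rw [hessMat_row, e, h.diff_normSqGrad hf0,
    vecDeriv_mulVec (h.smoothMat_hessMat hf0) (h.smoothVec_grad hf0), h.vecDeriv_grad hf0,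
    smul_vecMul, ← smul_sub, covDerivHess, sub_mulVec, sub_mulVec, mulVec_sub,
    ← mulVec_transpose, mulVec_mulVec _ _ (connMat G b y), mulVec_mulVec _ (connMat G b y)ᵀ]
  congr 1
  abel

omit hf in
theorem laplacian_eq_trace (hf0 : ContDiffAt ℝ ∞ f y) :
    laplacian G f y = ((G y)⁻¹ * hessMat G f y).trace := by
  conv_rhs => rw [← h.hessMat_transpose hf0]
  rfl

/-- `∂ᵢ Δf = tr ∇ᵢ ∇²f`, as the metric is parallel. -/
theorem partialDeriv_laplacian (i : Fin n) : partialDeriv i (laplacian G f) y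
    = ((G y)⁻¹ * covDerivHess G f i y).trace := by
  have hf0 := hf.self_of_nhds
  have e : laplacian G f =ᶠ[𝓝 y] fun z => ((G z)⁻¹ * hessMat G f z).trace := by
    filter_upwards [h.eventually, hf.eventually_nhds] with z hz hfz using
      hz.laplacian_eq_trace hfz.self_of_nhds
  rw [partialDeriv_congr e, partialDeriv_trace (h.smoothMat_inv.mul (h.smoothMat_hessMat hf0)),
    matDeriv_mul h.smoothMat_inv (h.smoothMat_hessMat hf0), h.matDeriv_inv, covDerivHess]
  simp only [Matrix.mul_sub, Matrix.sub_mul, Matrix.neg_mul, trace_add, trace_sub, trace_neg,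
    ← Matrix.mul_assoc]
  rw [Matrix.trace_mul_cycle ((G y)⁻¹) (hessMat G f y) (connMat G i y)]
  ring

omit hf in
/-- The curvature term of the Bochner formula. -/
theorem sum_inv_mul_curvMat (x : Fin n → ℝ) (i : Fin n) :
    ∑ b, ∑ a, (G y)⁻¹ b a * (x ᵥ* curvMat G i b y) a
      = ∑ a, ricci G a i y * ((G y)⁻¹ *ᵥ x) a := by
  have e : ∀ b, ∑ a, (G y)⁻¹ b a * (x ᵥ* curvMat G i b y) a
      = (curvMat G b i y *ᵥ ((G y)⁻¹ *ᵥ x)) b := by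
    intro b
    calc ∑ a, (G y)⁻¹ b a * (x ᵥ* curvMat G i b y) a
        = (((curvMat G i b y * (G y)⁻¹)ᵀ) *ᵥ x) b := by
          rw [mulVec_transpose, ← vecMul_vecMul]
          simp only [vecMul, dotProduct]
          refine Finset.sum_congr rfl fun a _ => ?_
          rw [mul_comm, ← transpose_apply ((G y)⁻¹) a b, h.inv_transpose]
      _ = _ := by
          rw [h.curvMat_mul_inv_antisymm, curvMat_swap i b, Matrix.neg_mul, neg_neg, mulVec_mulVec]
  simp only [e, h.ricci_eq_sum_curvMat, Finset.sum_mul]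
  rw [Finset.sum_comm]
  rfl

/-- The Bochner formula `½ Δ|∇f|² = |∇²f|² + ⟨∇f, ∇Δf⟩ + Ric(∇f, ∇f)`. -/
theorem bochner : laplacian G (normSqGrad G f) y
    = 2 * (((G y)⁻¹ * hessMat G f y * ((G y)⁻¹ * hessMat G f y)).trace
      + grad G f y ⬝ᵥ diff (laplacian G f) y
      + ∑ i, ∑ a, grad G f y i * grad G f y a * ricci G a i y) := by
  have hf0 := hf.self_of_nhds
  have e0 : laplacian G (normSqGrad G f) y
      = ∑ b, (G y)⁻¹ b ⬝ᵥ hessMat G (normSqGrad G f) y b := rfl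
  have e1 : ∑ b, (G y)⁻¹ b ⬝ᵥ (hessMat G f y *ᵥ ((G y)⁻¹ *ᵥ hessMat G f y b))
      = ((G y)⁻¹ * hessMat G f y * ((G y)⁻¹ * hessMat G f y)).trace := by
    refine Finset.sum_congr rfl fun b _ => ?_
    rw [mulVec_mulVec, dotProduct_mulVec, ← mul_apply_eq_vecMul, ← Matrix.mul_assoc,
      Matrix.diag_apply, ← Matrix.mul_assoc, mul_apply]
    refine Finset.sum_congr rfl fun c _ => ?_
    exact congrArg _ (h.hessian_comm hf0 b c)
  have e2 : ∑ b, (G y)⁻¹ b ⬝ᵥ (covDerivHess G f b y *ᵥ grad G f y)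
      = ∑ i, grad G f y i * (∑ b, ∑ a, (G y)⁻¹ b a * covDerivHess G f b y i a) := by
    simp only [dotProduct, mulVec, Finset.mul_sum]
    conv_rhs => rw [Finset.sum_comm]
    refine Finset.sum_congr rfl fun b _ => ?_
    rw [Finset.sum_comm]
    refine Finset.sum_congr rfl fun i _ => Finset.sum_congr rfl fun a _ => ?_
    rw [← congrFun (congrFun (h.covDerivHess_transpose hf b) a) i, transpose_apply]
    ring
  have e3 : ∀ i, ∑ b, ∑ a, (G y)⁻¹ b a * covDerivHess G f b y i a
      = diff (laplacian G f) y i + ∑ a, ricci G a i y * grad G f y a := by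
    intro i
    have hT : ∀ b a, covDerivHess G f b y i a
        = covDerivHess G f i y b a + (diff f y ᵥ* curvMat G i b y) a := by
      intro b a
      rw [← h.covDerivHess_sub_covDerivHess hf i b]
      simp
    simp only [hT, mul_add, Finset.sum_add_distrib]
    rw [h.sum_inv_mul_curvMat, show diff (laplacian G f) y i = _ from h.partialDeriv_laplacian hf i]
    conv_rhs => rw [← h.covDerivHess_transpose hf i]
    rfl
  rw [e0]
  simp only [h.hessMat_normSqGrad_row hf, dotProduct_smul, dotProduct_add, ← Finset.smul_sum,
    Finset.sum_add_distrib]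
  rw [e1, e2]
  simp only [e3, mul_add, Finset.sum_add_distrib, smul_eq_mul, dotProduct, Finset.mul_sum]
  rw [add_comm (∑ i, 2 * (_ * _) + _), ← add_assoc]
  refine congrArg _ ?_
  exact Finset.sum_congr rfl fun i _ => Finset.sum_congr rfl fun a _ => by ring

end IsMetricAt

end Coord

/-! ### Components of a metric in a chart -/

namespace Coord

/-- The differential of `f` applied to a vector, in components. -/
theorem fderiv_apply_eq_dotProduct {n : ℕ} (f : Model n → ℝ) (y v : Model n) :
    fderiv ℝ f y v = v.ofLp ⬝ᵥ diff f y := by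
  conv_lhs => rw [← (EuclideanSpace.basisFun (Fin n) ℝ).sum_repr v]
  simp [map_sum, dotProduct, diff, partialDeriv]

end Coord

namespace SmoothMetric

open Matrix Filter Topology

variable {n : ℕ} {M : Type*} [TopologicalSpace M] [ChartedSpace (Model n) M]
  [IsManifold 𝓘(ℝ, Model n) ∞ M] (g : SmoothMetric n M)
  {e : OpenPartialHomeomorph M (Model n)}

/-- The metric evaluated on pushforwards of coordinate vectors. -/
theorem inner_mfderiv_symm (e : OpenPartialHomeomorph M (Model n)) (y v w : Model n) :
    g.inner (e.symm y) (mfderiv 𝓘(ℝ, Model n) 𝓘(ℝ, Model n) e.symm y v)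
      (mfderiv 𝓘(ℝ, Model n) 𝓘(ℝ, Model n) e.symm y w) = v.ofLp ⬝ᵥ (g.comp e y *ᵥ w.ofLp) := by
  let B : Model n →L[ℝ] Model n →L[ℝ] ℝ := g.inner (e.symm y)
  let L : Model n →L[ℝ] Model n := mfderiv 𝓘(ℝ, Model n) 𝓘(ℝ, Model n) e.symm y
  change B (L v) (L w) = _
  have hc : ∀ i j, g.comp e y i j
      = B (L (EuclideanSpace.single i 1)) (L (EuclideanSpace.single j 1)) := fun i j => rfl
  have hexp : ∀ x : Model n, x = ∑ i, x i • EuclideanSpace.single i (1 : ℝ) := fun x => by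
    conv_lhs => rw [← (EuclideanSpace.basisFun (Fin n) ℝ).sum_repr x]
    simp
  conv_lhs => rw [hexp v, hexp w]
  simp only [map_sum, map_smul, _root_.sum_apply, _root_.smul_apply,
    smul_eq_mul, dotProduct, mulVec, hc]
  simp only [Finset.mul_sum]
  rw [Finset.sum_comm]
  refine Finset.sum_congr rfl fun i _ => ?_
  exact Finset.sum_congr rfl fun j _ => by ring

omit [IsManifold 𝓘(ℝ, Model n) ∞ M] in
theorem mdifferentiable_of_mem_maximalAtlas
    (he : e ∈ IsManifold.maximalAtlas 𝓘(ℝ, Model n) ∞ M) :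
    e.MDifferentiable 𝓘(ℝ, Model n) 𝓘(ℝ, Model n) :=
  ⟨(contMDiffOn_of_mem_maximalAtlas he).mdifferentiableOn (by simp),
    (contMDiffOn_symm_of_mem_maximalAtlas he).mdifferentiableOn (by simp)⟩

/-- The components of a smooth metric in a smooth chart are smooth. -/
theorem smoothMat_comp (he : e ∈ IsManifold.maximalAtlas 𝓘(ℝ, Model n) ∞ M) {y : Model n}
    (hy : y ∈ e.target) : Coord.SmoothMat (g.comp e) y := by
  have hsymm := contMDiffOn_symm_of_mem_maximalAtlas (I := 𝓘(ℝ, Model n)) (n := ∞) he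
  have hX : ∀ i : Fin n, ContMDiffOn 𝓘(ℝ, Model n) (𝓘(ℝ, Model n).prod 𝓘(ℝ, Model n)) ∞
      (fun z => Bundle.TotalSpace.mk' (Model n) (E := fun x : M => TangentSpace 𝓘(ℝ, Model n) x)
        (e.symm z) (mfderiv 𝓘(ℝ, Model n) 𝓘(ℝ, Model n) e.symm z (EuclideanSpace.single i (1 : ℝ))))
      e.target := by
    intro i
    have h1 := hsymm.contMDiffOn_tangentMapWithin (m := ∞) (by simp)
      e.open_target.uniqueMDiffOn
    have h2 : ContMDiff 𝓘(ℝ, Model n) (𝓘(ℝ, Model n).prod 𝓘(ℝ, Model n)) ∞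
        (fun z : Model n => Bundle.TotalSpace.mk' (Model n)
          (E := fun x : Model n => TangentSpace 𝓘(ℝ, Model n) x) z
          (EuclideanSpace.single i (1 : ℝ) : Model n)) := by
      exact contMDiff_vectorSpace_iff_contDiff.2 contDiff_const
    refine (h1.comp h2.contMDiffOn fun z hz => hz).congr fun z hz => ?_
    simp only [Function.comp, tangentMapWithin]
    rw [mfderivWithin_of_isOpen e.open_target hz]
  intro i j
  have hg : ContMDiffOn 𝓘(ℝ, Model n)
      (𝓘(ℝ, Model n).prod 𝓘(ℝ, Model n →L[ℝ] Model n →L[ℝ] ℝ)) ∞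
      (fun z => Bundle.TotalSpace.mk' (Model n →L[ℝ] Model n →L[ℝ] ℝ)
        (E := fun x : M => TangentSpace 𝓘(ℝ, Model n) x →L[ℝ] TangentSpace 𝓘(ℝ, Model n) x →L[ℝ] ℝ)
        (e.symm z) (g.inner (e.symm z))) e.target :=
    g.contMDiff.comp_contMDiffOn hsymm
  have := ContMDiffOn.clm_bundle_apply₂ (F₁ := Model n) (F₂ := Model n) (F₃ := ℝ)
    (E₁ := fun x : M => TangentSpace 𝓘(ℝ, Model n) x)
    (E₂ := fun x : M => TangentSpace 𝓘(ℝ, Model n) x) (E₃ := fun _ : M => ℝ)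
    hg (hX i) (hX j)
  have h3 := (this y hy).contMDiffAt (e.open_target.mem_nhds hy)
  simp only [Bundle.contMDiffAt_totalSpace] at h3
  exact h3.2.contDiffAt

theorem posDef_comp (he : e ∈ IsManifold.maximalAtlas 𝓘(ℝ, Model n) ∞ M) {y : Model n}
    (hy : y ∈ e.target) : (g.comp e y).PosDef := by
  refine Matrix.PosDef.of_dotProduct_mulVec_pos ?_ fun v hv => ?_
  · ext i j
    simp only [conjTranspose_apply, comp, of_apply, star_trivial]
    exact g.symm _ _ _
  · have h := g.inner_mfderiv_symm e y (WithLp.toLp 2 v) (WithLp.toLp 2 v)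
    simp only [star_trivial]
    rw [← h]
    refine g.pos _ _ fun h0 => hv ?_
    have hinj := (mdifferentiable_of_mem_maximalAtlas he).symm.mfderiv_injective hy
    have := hinj (h0.trans (map_zero _).symm)
    exact congrArg WithLp.ofLp this

theorem isMetricAt_comp (he : e ∈ IsManifold.maximalAtlas 𝓘(ℝ, Model n) ∞ M) {y : Model n}
    (hy : y ∈ e.target) : Coord.IsMetricAt (g.comp e) y where
  smooth := Filter.mem_of_superset (e.open_target.mem_nhds hy) fun _ hz => g.smoothMat_comp he hz
  posDef := Filter.mem_of_superset (e.open_target.mem_nhds hy) fun _ hz => g.posDef_comp he hz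

omit [IsManifold 𝓘(ℝ, Model n) ∞ M] in
theorem _root_.ContMDiff.contDiffAt_comp_symm {u : M → ℝ}
    (hu : ContMDiff 𝓘(ℝ, Model n) 𝓘(ℝ, ℝ) ∞ u)
    (he : e ∈ IsManifold.maximalAtlas 𝓘(ℝ, Model n) ∞ M) {y : Model n} (hy : y ∈ e.target) :
    ContDiffAt ℝ ∞ (u ∘ e.symm) y :=
  (hu.contMDiffAt.comp y (contMDiffAt_symm_of_mem_maximalAtlas he hy)).contDiffAt

/-- The coordinate expression `|∇u|² = Gⁱʲ ∂ᵢu ∂ⱼu`. -/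
theorem gradNormSq_symm {u : M → ℝ} (hu : ContMDiff 𝓘(ℝ, Model n) 𝓘(ℝ, ℝ) ∞ u)
    (he : e ∈ IsManifold.maximalAtlas 𝓘(ℝ, Model n) ∞ M) {y : Model n} (hy : y ∈ e.target) :
    g.gradNormSq u (e.symm y) = Coord.normSqGrad (g.comp e) (u ∘ e.symm) y := by
  have hmd := (mdifferentiable_of_mem_maximalAtlas he).symm
  obtain ⟨v, hv⟩ := hmd.mfderiv_surjective hy (g.gradient u (e.symm y))
  change Model n at v
  have hdu : ∀ w : Model n, g.inner (e.symm y) (g.gradient u (e.symm y))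
      (mfderiv 𝓘(ℝ, Model n) 𝓘(ℝ, Model n) e.symm y w)
      = w.ofLp ⬝ᵥ Coord.diff (u ∘ e.symm) y := by
    intro w
    rw [g.inner_gradient, ← Coord.fderiv_apply_eq_dotProduct, ← mfderiv_eq_fderiv,
      mfderiv_comp y (hu.mdifferentiableAt (by simp)) (hmd.mdifferentiableAt hy)]
    rfl
  have hm := g.isMetricAt_comp he hy
  have hGv : g.comp e y *ᵥ v.ofLp = Coord.diff (u ∘ e.symm) y := by
    ext j
    have h1 := hdu (EuclideanSpace.single j 1)
    rw [← hv, g.inner_mfderiv_symm, dotProduct_mulVec, ← mulVec_transpose, hm.transpose_eq] at h1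
    simpa using h1
  have hvP : v.ofLp = Coord.grad (g.comp e) (u ∘ e.symm) y := by
    rw [Coord.grad, ← hGv, mulVec_mulVec, nonsing_inv_mul _ hm.isUnit_det, one_mulVec]
  rw [gradNormSq]
  conv_lhs => enter [2]; rw [← hv]
  rw [hdu v, hvP, Coord.normSqGrad, dotProduct_comm]

end SmoothMetric

/-! ### The second order test at a maximum -/

namespace Coord

open Matrix Filter Topology

variable {n : ℕ}

open scoped ComplexOrder MatrixOrder in
theorem exists_eq_transpose_mul_self {P : Matrix (Fin n) (Fin n) ℝ} (hP : P.PosSemidef) :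
    ∃ A : Matrix (Fin n) (Fin n) ℝ, P = Aᵀ * A := by
  obtain ⟨A, hA⟩ := CStarAlgebra.nonneg_iff_eq_star_mul_self.1 hP.nonneg
  exact ⟨A, by rw [hA, star_eq_conjTranspose, conjTranspose_eq_transpose_of_trivial]⟩

/-- The Cauchy-Schwarz inequality `(tr K)² ≤ n |K|²` for a symmetric form `K`, with trace and norm
taken with respect to the positive definite form `P` on covectors. -/
theorem trace_sq_le_card_mul_trace_sq {P K : Matrix (Fin n) (Fin n) ℝ} (hP : P.PosSemidef)
    (hK : Kᵀ = K) : (P * K).trace ^ 2 ≤ n * (P * K * (P * K)).trace := by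
  obtain ⟨A, rfl⟩ := exists_eq_transpose_mul_self hP
  set L := A * K * Aᵀ with hL
  have hLt : Lᵀ = L := by
    rw [hL, transpose_mul, transpose_mul, transpose_transpose, hK, Matrix.mul_assoc]
  have e1 : (Aᵀ * A * K).trace = L.trace := by
    rw [Matrix.mul_assoc, trace_mul_comm]
  have e2 : (Aᵀ * A * K * (Aᵀ * A * K)).trace = (L * L).trace := by
    rw [show Aᵀ * A * K * (Aᵀ * A * K) = Aᵀ * (A * K * Aᵀ * (A * K)) by
      simp only [Matrix.mul_assoc], trace_mul_comm, hL]
    simp only [Matrix.mul_assoc]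
  rw [e1, e2]
  calc L.trace ^ 2 ≤ n * ∑ i, L i i ^ 2 := by
        simpa [Matrix.trace] using
          sq_sum_le_card_mul_sum_sq (s := Finset.univ) (f := fun i => L i i)
    _ ≤ n * (L * L).trace := by
        gcongr
        refine Finset.sum_le_sum fun i _ => ?_
        rw [Matrix.diag_apply, mul_apply]
        have : ∀ j, L i j * L j i = L i j ^ 2 := fun j => by
          rw [sq, ← transpose_apply L i j, hLt]
        simp only [this]
        exact Finset.single_le_sum (f := fun j => L i j ^ 2) (fun j _ => sq_nonneg _)
          (Finset.mem_univ i)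

/-- The second derivative of `f` in a fixed direction is nonpositive at a local maximum. -/
theorem sum_partialDeriv_partialDeriv_nonpos_of_isLocalMax {f : Model n → ℝ} {y : Model n}
    (hf : ∀ᶠ z in 𝓝 y, ContDiffAt ℝ ∞ f z) (hmax : IsLocalMax f y) (v : Fin n → ℝ) :
    ∑ j, ∑ i, v j * v i * partialDeriv i (partialDeriv j f) y ≤ 0 := by
  have hline : ∀ t : ℝ, HasDerivAt (fun t : ℝ => y + t • WithLp.toLp 2 v) (WithLp.toLp 2 v) t :=
    fun t => by simpa using ((hasDerivAt_id t).smul_const (WithLp.toLp 2 v)).const_add y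
  have hcont : Tendsto (fun t : ℝ => y + t • WithLp.toLp 2 v) (𝓝 0) (𝓝 y) := by
    simpa using (hline 0).continuousAt.tendsto
  have h0 : y + (0 : ℝ) • WithLp.toLp 2 v = y := by simp
  have hder : ∀ g : Model n → ℝ, ∀ t : ℝ,
      ContDiffAt ℝ ∞ g (y + t • WithLp.toLp 2 v) →
      HasDerivAt (fun t : ℝ => g (y + t • WithLp.toLp 2 v))
        (∑ i, v i * partialDeriv i g (y + t • WithLp.toLp 2 v)) t := by
    intro g t hg
    have := (hg.differentiableAt (by simp)).hasFDerivAt.comp_hasDerivAt t (hline t)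
    rwa [fderiv_apply_eq_dotProduct] at this
  set φ : ℝ → ℝ := fun t => f (y + t • WithLp.toLp 2 v)
  have hmaxφ : IsLocalMax φ 0 := by
    have := hcont.eventually hmax
    filter_upwards [this] with t ht
    simpa [φ] using ht
  have hd1 : deriv φ =ᶠ[𝓝 0]
      fun t => ∑ j, v j * partialDeriv j f (y + t • WithLp.toLp 2 v) := by
    filter_upwards [hcont.eventually hf] with t ht using (hder f t ht).deriv
  have hd2 : deriv (deriv φ) 0 = ∑ j, ∑ i, v j * v i * partialDeriv i (partialDeriv j f) y := by
    rw [hd1.deriv_eq]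
    have hs : HasDerivAt (fun t : ℝ => ∑ j, v j * partialDeriv j f (y + t • WithLp.toLp 2 v))
        (∑ j, v j * ∑ i, v i * partialDeriv i (partialDeriv j f)
          (y + (0 : ℝ) • WithLp.toLp 2 v)) 0 :=
      HasDerivAt.fun_sum fun j _ => (hder (partialDeriv j f) 0
        (by rw [h0]; exact hf.self_of_nhds.partialDeriv j)).const_mul (v j)
    rw [hs.deriv, h0]
    simp only [Finset.mul_sum, mul_assoc]
  rw [← hd2]
  by_contra! hpos
  -- a positive second derivative would also make `0` a local minimum, hence `φ` locally constant
  have hφc : ContinuousAt φ 0 := (hder f 0 (by rw [h0]; exact hf.self_of_nhds)).continuousAt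
  have hmin := isLocalMin_of_deriv_deriv_pos hpos hmaxφ.deriv_eq_zero hφc
  have hconst : φ =ᶠ[𝓝 0] fun _ => φ 0 := by
    filter_upwards [hmaxφ, hmin] with t h1 h2 using le_antisymm h1 h2
  have : deriv (deriv φ) 0 = 0 := by
    rw [hconst.deriv.deriv_eq]
    simp
  exact hpos.ne' this

variable {G : Model n → Matrix (Fin n) (Fin n) ℝ} {f : Model n → ℝ} {y : Model n}

theorem diff_eq_zero_of_isLocalMax (hmax : IsLocalMax f y) : diff f y = 0 := by
  ext i
  simp [diff, partialDeriv, hmax.fderiv_eq_zero]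

namespace IsMetricAt

theorem posDef_inv (h : IsMetricAt G y) : ((G y)⁻¹).PosDef := h.posDef.self_of_nhds.inv

theorem normSqGrad_nonneg (h : IsMetricAt G y) (f : Model n → ℝ) : 0 ≤ normSqGrad G f y := by
  simpa [normSqGrad, grad] using h.posDef_inv.posSemidef.dotProduct_mulVec_nonneg (diff f y)

theorem laplacian_nonpos_of_isLocalMax (h : IsMetricAt G y)
    (hf : ∀ᶠ z in 𝓝 y, ContDiffAt ℝ ∞ f z) (hmax : IsLocalMax f y) : laplacian G f y ≤ 0 := by
  have hd := diff_eq_zero_of_isLocalMax hmax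
  have hf0 := hf.self_of_nhds
  obtain ⟨A, hA⟩ := exists_eq_transpose_mul_self h.posDef_inv.posSemidef
  have key : ∀ i j, hessMat G f y i j = partialDeriv i (partialDeriv j f) y := by
    intro i j
    have : ∀ k, partialDeriv k f y = 0 := fun k => congrFun hd k
    simp [hessMat, hessian, this]
  rw [h.laplacian_eq_trace hf0, hA, Matrix.mul_assoc,
    trace_mul_comm]
  refine Finset.sum_nonpos fun l _ => ?_
  refine le_of_eq_of_le ?_
    (sum_partialDeriv_partialDeriv_nonpos_of_isLocalMax hf hmax fun i => A l i)
  simp only [Matrix.diag_apply, mul_apply, transpose_apply, key, Finset.sum_mul]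
  exact Finset.sum_congr rfl fun j _ => Finset.sum_congr rfl fun i _ => by ring

/-- The Laplacian of `w + ψ ∘ f`. -/
theorem laplacian_add_comp {w : Model n → ℝ}
    (hwe : ∀ᶠ z in 𝓝 y, ContDiffAt ℝ ∞ w z) (hf : ∀ᶠ z in 𝓝 y, ContDiffAt ℝ ∞ f z)
    {ψ : ℝ → ℝ} (hψ : ContDiff ℝ ∞ ψ) :
    laplacian G (fun z => w z + ψ (f z)) y = laplacian G w y
      + deriv ψ (f y) * laplacian G f y + deriv (deriv ψ) (f y) * normSqGrad G f y := by
  have hf0 := hf.self_of_nhds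
  have hw := hwe.self_of_nhds
  have hψ1 : ContDiff ℝ ∞ (deriv ψ) := (contDiff_infty_iff_deriv.1 hψ).2
  have h1 : ∀ j z, ContDiffAt ℝ ∞ w z → ContDiffAt ℝ ∞ f z →
      partialDeriv j (fun z => w z + ψ (f z)) z
        = partialDeriv j w z + deriv ψ (f z) * partialDeriv j f z := fun j z hwz hfz => by
    have hc : ContDiffAt ℝ ∞ (fun z => ψ (f z)) z := hψ.contDiffAt.comp z hfz
    rw [partialDeriv_add hwz hc, partialDeriv_comp hfz (hψ.differentiable (by simp) _)]
  have h2 : ∀ i j, partialDeriv i (partialDeriv j (fun z => w z + ψ (f z))) y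
      = partialDeriv i (partialDeriv j w) y + (deriv (deriv ψ) (f y) * partialDeriv i f y
        * partialDeriv j f y + deriv ψ (f y) * partialDeriv i (partialDeriv j f) y) := by
    intro i j
    have e : partialDeriv j (fun z => w z + ψ (f z)) =ᶠ[𝓝 y]
        fun z => partialDeriv j w z + deriv ψ (f z) * partialDeriv j f z := by
      filter_upwards [hwe, hf] with z hwz hfz using h1 j z hwz hfz
    have hc : ContDiffAt ℝ ∞ (fun z => deriv ψ (f z)) y := hψ1.contDiffAt.comp y hf0
    rw [partialDeriv_congr e, partialDeriv_add (hw.partialDeriv j) (hc.mul (hf0.partialDeriv j)),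
      partialDeriv_mul hc (hf0.partialDeriv j),
      partialDeriv_comp hf0 (hψ1.differentiable (by simp) _)]
  have h3 : ∀ i j, hessian G (fun z => w z + ψ (f z)) i j y
      = hessian G w i j y + deriv ψ (f y) * hessian G f i j y
        + deriv (deriv ψ) (f y) * (partialDeriv i f y * partialDeriv j f y) := by
    intro i j
    simp only [hessian, h2, h1 _ y hw hf0, mul_add, Finset.sum_add_distrib]
    have : ∑ k, christoffel G k i j y * (deriv ψ (f y) * partialDeriv k f y)
        = deriv ψ (f y) * ∑ k, christoffel G k i j y * partialDeriv k f y := by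
      rw [Finset.mul_sum]; exact Finset.sum_congr rfl fun k _ => by ring
    rw [this]; ring
  simp only [laplacian, trace, h3, normSqGrad, grad, diff, dotProduct, mulVec, Finset.mul_sum,
    mul_add, Finset.sum_add_distrib]
  congr 1
  · congr 1
    exact Finset.sum_congr rfl fun i _ => Finset.sum_congr rfl fun j _ => by ring
  · exact Finset.sum_congr rfl fun i _ => Finset.sum_congr rfl fun j _ => by ring

end IsMetricAt

end Coord

/-! ### The gradient estimate -/

namespace Coord

open Matrix Filter Topology

variable {n : ℕ} {G : Model n → Matrix (Fin n) (Fin n) ℝ} {f : Model n → ℝ} {y : Model n}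

/-- The first and second order conditions at a local maximum of `|∇f|² + ψ(f)`, combined with the
Bochner formula and the Cauchy-Schwarz inequality `n |∇²f|² ≥ (Δf)²`. -/
theorem IsMetricAt.laplacian_sq_le_of_isLocalMax (h : IsMetricAt G y)
    (hf : ∀ᶠ z in 𝓝 y, ContDiffAt ℝ ∞ f z) (hpos : 0 < f y) {p mu N lam : ℝ}
    (hRic : ∀ i j, ricci G i j y - p * (f y)⁻¹ * hessian G f i j y = mu * G y i j)
    (hLap : ∀ᶠ z in 𝓝 y, f z * laplacian G f z = N * normSqGrad G f z + lam - mu * f z ^ 2)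
    {ψ : ℝ → ℝ} (hψ : ContDiff ℝ ∞ ψ)
    (hmax : IsLocalMax (fun z => normSqGrad G f z + ψ (f z)) y) :
    2 * laplacian G f y ^ 2 + n * (deriv ψ (f y) * laplacian G f y
      + normSqGrad G f y * (deriv (deriv ψ) (f y) - (2 * N + p) * deriv ψ (f y) / f y
        - 2 * mu - 2 * laplacian G f y / f y)) ≤ 0 := by
  have hf0 := hf.self_of_nhds
  have hw : ∀ᶠ z in 𝓝 y, ContDiffAt ℝ ∞ (normSqGrad G f) z := by
    filter_upwards [h.eventually, hf] with z hz hfz using hz.smooth_normSqGrad hfz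
  have hw0 := hw.self_of_nhds
  have hψf : ∀ z, ContDiffAt ℝ ∞ f z → ContDiffAt ℝ ∞ (fun z => ψ (f z)) z :=
    fun z hz => hψ.contDiffAt.comp z hz
  have hv : grad G f y ⬝ᵥ diff f y = normSqGrad G f y := dotProduct_comm _ _
  have hGv : G y *ᵥ grad G f y = diff f y := by
    rw [grad, mulVec_mulVec, mul_nonsing_inv _ h.isUnit_det, one_mulVec]
  -- the first order condition
  have h1 : diff (normSqGrad G f) y = -deriv ψ (f y) • diff f y := by
    ext i
    have := congrFun (diff_eq_zero_of_isLocalMax hmax) i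
    simp only [diff] at this
    rw [partialDeriv_add hw0 (hψf y hf0),
      partialDeriv_comp hf0 (hψ.differentiable (by simp) _)] at this
    simp only [diff, Pi.smul_apply, smul_eq_mul, Pi.zero_apply] at this ⊢
    linarith
  -- the second order condition
  have h2 : laplacian G (normSqGrad G f) y + deriv ψ (f y) * laplacian G f y
      + deriv (deriv ψ) (f y) * normSqGrad G f y ≤ 0 := by
    rw [← laplacian_add_comp hw hf hψ]
    refine h.laplacian_nonpos_of_isLocalMax ?_ hmax
    filter_upwards [hw, hf] with z hz hfz using hz.add (hψf z hfz)
  have hS : 2 * (grad G f y ⬝ᵥ (hessMat G f y *ᵥ grad G f y))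
      = -deriv ψ (f y) * normSqGrad G f y := by
    have := congrArg (grad G f y ⬝ᵥ ·) ((h.diff_normSqGrad hf0).symm.trans h1)
    simpa [dotProduct_smul, hv] using this
  -- the gradient of the equation for the Laplacian
  have hB : normSqGrad G f y * laplacian G f y
      + f y * (grad G f y ⬝ᵥ diff (laplacian G f) y)
      = -N * deriv ψ (f y) * normSqGrad G f y - 2 * mu * f y * normSqGrad G f y := by
    have hlap : ContDiffAt ℝ ∞ (laplacian G f) y := by
      unfold laplacian trace
      exact ContDiffAt.sum fun i _ => ContDiffAt.sum fun j _ =>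
        (h.smoothMat_inv i j).mul (h.smoothMat_hessMat hf0 i j)
    have e : ∀ i, partialDeriv i f y * laplacian G f y + f y * partialDeriv i (laplacian G f) y
        = -N * deriv ψ (f y) * partialDeriv i f y - 2 * mu * f y * partialDeriv i f y := by
      intro i
      have hi : partialDeriv i (normSqGrad G f) y = -deriv ψ (f y) * partialDeriv i f y :=
        congrFun h1 i
      have hsq : ContDiffAt ℝ ∞ (fun z => f z * f z) y := hf0.mul hf0
      have hNw : ContDiffAt ℝ ∞ (fun z => N * normSqGrad G f z + lam) y :=
        (contDiffAt_const.mul hw0).add contDiffAt_const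
      have hE : (fun z => f z * laplacian G f z) =ᶠ[𝓝 y]
          fun z => (N * normSqGrad G f z + lam) - mu * (f z * f z) := by
        filter_upwards [hLap] with z hz
        rw [hz]; ring
      have := partialDeriv_congr hE i
      rw [partialDeriv_mul hf0 hlap, partialDeriv_sub hNw (contDiffAt_const.mul hsq),
        partialDeriv_add (contDiffAt_const.mul hw0) contDiffAt_const,
        partialDeriv_mul contDiffAt_const hw0, partialDeriv_mul contDiffAt_const hsq,
        partialDeriv_mul hf0 hf0, partialDeriv_const, partialDeriv_const, partialDeriv_const,
        hi] at this
      rw [this]; ring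
    rw [← hv]
    simp only [dotProduct, Finset.mul_sum, Finset.sum_mul, ← Finset.sum_add_distrib,
      ← Finset.sum_sub_distrib]
    refine Finset.sum_congr rfl fun i _ => ?_
    have := congrArg (grad G f y i * ·) (e i)
    simp only [diff] at this ⊢
    linarith
  -- the quasi-Einstein equation evaluated on the gradient
  have hR : ∑ i, ∑ a, grad G f y i * grad G f y a * ricci G a i y
      = mu * normSqGrad G f y
        + p * (f y)⁻¹ * (grad G f y ⬝ᵥ (hessMat G f y *ᵥ grad G f y)) := by
    rw [← hv]
    conv_rhs => rw [← hGv]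
    simp only [dotProduct, mulVec, Finset.mul_sum, ← Finset.sum_add_distrib]
    rw [Finset.sum_comm]
    refine Finset.sum_congr rfl fun i _ => Finset.sum_congr rfl fun a _ => ?_
    rw [eq_add_of_sub_eq (hRic i a), hessMat, of_apply]
    ring
  have hCS := trace_sq_le_card_mul_trace_sq h.posDef_inv.posSemidef (h.hessMat_transpose hf0)
  rw [← h.laplacian_eq_trace hf0] at hCS
  rw [h.bochner hf, hR] at h2
  generalize ((G y)⁻¹ * hessMat G f y * ((G y)⁻¹ * hessMat G f y)).trace = Q at hCS h2
  generalize grad G f y ⬝ᵥ (hessMat G f y *ᵥ grad G f y) = S at hS h2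
  generalize grad G f y ⬝ᵥ diff (laplacian G f) y = B at hB h2
  generalize laplacian G f y = D at *
  generalize normSqGrad G f y = w at *
  generalize deriv (deriv ψ) (f y) = d2 at *
  generalize deriv ψ (f y) = d1 at *
  have hB' : B = (-N * d1 * w - 2 * mu * f y * w - w * D) / f y := by
    rw [eq_div_iff hpos.ne']; linarith
  have hS' : S = -d1 * w / 2 := by linarith
  have key : 2 * Q + (d1 * D + w * (d2 - (2 * N + p) * d1 / f y - 2 * mu - 2 * D / f y)) ≤ 0 := by
    refine le_of_eq_of_le ?_ h2
    rw [hB', hS']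
    field_simp
    ring
  nlinarith [mul_le_mul_of_nonneg_left key (Nat.cast_nonneg (α := ℝ) n)]

end Coord

/-- The algebra behind the maximum principle. Here `t = ε fᵏ` is the size of the perturbation and
`h` the maximum of `(w + lam / N) / f² + ε fᵏ`, which exceeds `c = mu / (m - 1)`. The exponent `k`
is large enough to absorb the first order terms, and `t` is small enough to make `Δf` positive. -/
theorem false_of_perturbed_max {n m N c mu p a t h f w D d1 d2 k : ℝ} (hn : 1 ≤ n) (hm : 1 < m)
    (hN : N = m + n - 1) (hp : p = 2 - m - n) (hmu : mu = c * (m - 1)) (hf : 0 < f)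
    (hw : 0 ≤ w) (ht : 0 < t) (hk : 2 * m + n ≤ k) (hsmall : N * t ≤ n * c) (hh : c < h)
    (hval : w + a = (h - t) * f ^ 2) (hD : f * D = N * (w + a) - mu * f ^ 2)
    (hd1 : d1 = f * (k * t - 2 * (h - t))) (hd2 : d2 = t * (k + 2) * (k + 1) - 2 * h)
    (hineq : 2 * D ^ 2 + n * (d1 * D + w * (d2 - (2 * N + p) * d1 / f - 2 * mu - 2 * D / f)) ≤ 0) :
    False := by
  set Y := N * (h - t) - mu with hY
  have hNpos : 0 < N := by linarith
  have hDY : D = f * Y := by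
    have : f * D = f * (f * Y) := by rw [hD, hval, hY]; ring
    exact mul_left_cancel₀ hf.ne' this
  have hYpos : 0 < Y := by
    have : N * c < N * h := mul_lt_mul_of_pos_left hh hNpos
    have : N * c = mu + n * c := by rw [hN, hmu]; ring
    rw [hY]; linarith
  have e : d2 - (2 * N + p) * d1 / f - 2 * mu - 2 * D / f = k * t * (k + 2 - N) := by
    rw [hd2, hd1, hDY, mul_div_assoc, mul_div_cancel_left₀ _ hf.ne', mul_div_assoc,
      mul_div_cancel_left₀ _ hf.ne', hY, hp, hN]
    ring
  have hnonneg : 0 ≤ w * (k * t * (k + 2 - N)) :=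
    mul_nonneg hw (mul_nonneg (mul_nonneg (by linarith) ht.le) (by linarith))
  rw [e] at hineq
  have h1 : 2 * D ^ 2 + n * (d1 * D) ≤ 0 := by nlinarith
  have h2 : f ^ 2 * Y * (2 * Y + n * (k * t - 2 * (h - t))) ≤ 0 := by
    refine le_of_eq_of_le ?_ h1
    rw [hDY, hd1]; ring
  have h3 : 2 * Y + n * (k * t - 2 * (h - t)) ≤ 0 :=
    nonpos_of_mul_nonpos_right h2 (by positivity)
  have h4 : 2 * Y + n * (k * t - 2 * (h - t))
      = 2 * (m - 1) * (h - c) + t * (n * k - 2 * (m - 1)) := by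
    rw [hY, hN, hmu]; ring
  have h5 : 0 < 2 * (m - 1) * (h - c) := mul_pos (by linarith) (by linarith)
  have h6 : 0 ≤ t * (n * k - 2 * (m - 1)) := mul_nonneg ht.le (by nlinarith)
  linarith

section

open Filter Topology

variable {n : ℕ} {M : Type*} [TopologicalSpace M] [ChartedSpace (Model n) M]
  [IsManifold 𝓘(ℝ, Model n) ∞ M]

theorem SmoothMetric.continuous_gradNormSq (g : SmoothMetric n M) {u : M → ℝ}
    (hu : ContMDiff 𝓘(ℝ, Model n) 𝓘(ℝ, ℝ) ∞ u) : Continuous (g.gradNormSq u) := by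
  rw [continuous_iff_continuousAt]
  intro x
  set e := chartAt (Model n) x
  have he := IsManifold.chart_mem_maximalAtlas (I := 𝓘(ℝ, Model n)) (n := ∞) x
  have hx : x ∈ e.source := mem_chart_source _ x
  have hy := e.map_source hx
  have h1 : ContinuousAt (Coord.normSqGrad (g.comp e) (u ∘ e.symm) ∘ e) x :=
    ContinuousAt.comp ((g.isMetricAt_comp he hy).smooth_normSqGrad
      (hu.contDiffAt_comp_symm he hy)).continuousAt (e.continuousAt hx)
  refine h1.congr ?_
  filter_upwards [e.open_source.mem_nhds hx] with z hz
  rw [Function.comp, ← g.gradNormSq_symm hu he (e.map_source hz), e.left_inv hz]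

/-- The equation `v Δv = (1 - m) |∇v|² + d - c v²` satisfied by the density of a quasi-Einstein
space of dimensional parameter `m ≠ 0`: the difference between the definition of the
characteristic constant and the trace of the quasi-Einstein equation. -/
theorem SMMS.IsQuasiEinstein.mul_laplacian {S : SMMS n M} {c d : ℝ} (hdim : S.dim ≠ 0)
    (hqe : S.IsQuasiEinstein c) (hchar : S.IsCharacteristicConstant c d)
    {e : OpenPartialHomeomorph M (Model n)}
    (he : e ∈ IsManifold.maximalAtlas 𝓘(ℝ, Model n) ∞ M) {y : Model n} (hy : y ∈ e.target) :
    S.v (e.symm y) * Coord.laplacian (S.metric.comp e) (S.v ∘ e.symm) y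
      = (1 - S.dim) * S.metric.gradNormSq S.v (e.symm y) + d - c * S.v (e.symm y) ^ 2 := by
  have hm := S.metric.isMetricAt_comp he hy
  have htr : Coord.scalarCurvature (S.metric.comp e) y - S.dim * (S.v (e.symm y))⁻¹
      * Coord.laplacian (S.metric.comp e) (S.v ∘ e.symm) y = n * c := by
    have h1 : ∑ i, ∑ j, (S.metric.comp e y)⁻¹ i j * S.bakryEmeryRicci e i j y = n * c := by
      have h2 : ∀ i, ∑ j, (S.metric.comp e y)⁻¹ i j * S.bakryEmeryRicci e i j y = c := by
        intro i
        have h3 : ∑ j, (S.metric.comp e y)⁻¹ i j * S.metric.comp e y j i = 1 := by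
          rw [← Matrix.mul_apply, Matrix.nonsing_inv_mul _ hm.isUnit_det, Matrix.one_apply_eq]
        calc _ = c * ∑ j, (S.metric.comp e y)⁻¹ i j * S.metric.comp e y j i := by
              rw [Finset.mul_sum]
              refine Finset.sum_congr rfl fun j _ => ?_
              rw [hqe e he y hy i j, hm.apply_comm i j]
              ring
          _ = c := by rw [h3, mul_one]
      simp [h2]
    rw [← h1]
    simp only [Coord.scalarCurvature, Coord.laplacian, Coord.trace, SMMS.bakryEmeryRicci,
      Finset.mul_sum, mul_sub, Finset.sum_sub_distrib]
    congr 1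
    exact Finset.sum_congr rfl fun i _ => Finset.sum_congr rfl fun j _ => by ring
  have hc := hchar e he y hy
  rw [SMMS.weightedScalarCurvature, eq_add_of_sub_eq htr] at hc
  have hv := S.pos_v (e.symm y)
  field_simp at hc
  have : S.dim * (S.v (e.symm y) * Coord.laplacian (S.metric.comp e) (S.v ∘ e.symm) y)
      = S.dim * ((1 - S.dim) * S.metric.gradNormSq S.v (e.symm y) + d
        - c * S.v (e.symm y) ^ 2) := by
    linear_combination -hc
  exact mul_left_cancel₀ hdim this

end

theorem mainTheorem6 {n : ℕ} (hn : 1 ≤ n) {M : Type*} [TopologicalSpace M] [T2Space M]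
    [CompactSpace M] [ChartedSpace (Model n) M] [IsManifold 𝓘(ℝ, Model n) ∞ M]
    (g : SmoothMetric n M) (u : M → ℝ) (hu : ContMDiff 𝓘(ℝ, Model n) 𝓘(ℝ, ℝ) ∞ u)
    (hpos : ∀ x, 0 < u x) (m : ℝ) (hm : 1 < m) (mu lam : ℝ) (hmu : 0 < mu)
    (hqe : (SMMS.mk g u hu hpos (2 - m - n)).IsQuasiEinstein mu)
    (hchar : (SMMS.mk g u hu hpos (2 - m - n)).IsCharacteristicConstant mu lam) :
    ∀ x : M, g.gradNormSq u x + lam / (m + n - 1) < mu / (m - 1) * u x ^ 2 := by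
  intro x
  by_contra! hx
  have hn' : (1 : ℝ) ≤ n := by exact_mod_cast hn
  set N : ℝ := m + n - 1 with hN
  set a : ℝ := lam / N with ha
  set c : ℝ := mu / (m - 1) with hc
  have hNpos : 0 < N := by linarith
  have hcpos : 0 < c := div_pos hmu (by linarith)
  have hlam : lam = N * a := by rw [ha, mul_div_cancel₀ _ hNpos.ne']
  have hmuc : mu = c * (m - 1) := by rw [hc, div_mul_cancel₀ _ (by linarith)]
  obtain ⟨k, hk⟩ := exists_nat_ge (2 * m + n)
  have hcu : Continuous u := hu.continuous
  obtain ⟨x1, -, hx1⟩ := isCompact_univ.exists_isMaxOn ⟨x, Set.mem_univ x⟩ hcu.continuousOn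
  -- the perturbation is normalised by `N ε (max u)ᵏ = n c`
  set ε : ℝ := n * c / N / u x1 ^ k with hε
  have hεpos : 0 < ε := by have := hpos x1; positivity
  have hεle : ∀ z, N * (ε * u z ^ k) ≤ n * c := by
    intro z
    have h1 : u z ^ k ≤ u x1 ^ k := pow_le_pow_left₀ (hpos z).le (hx1 (Set.mem_univ z)) k
    calc N * (ε * u z ^ k) ≤ N * (ε * u x1 ^ k) := by gcongr
      _ = n * c := by have := hpos x1; rw [hε]; field_simp
  have hcont : Continuous fun z => (g.gradNormSq u z + a) / u z ^ 2 + ε * u z ^ k :=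
    (((g.continuous_gradNormSq hu).add continuous_const).div (hcu.pow 2)
      fun z => (pow_pos (hpos z) 2).ne').add (continuous_const.mul (hcu.pow k))
  obtain ⟨y0, -, hy0⟩ := isCompact_univ.exists_isMaxOn ⟨x, Set.mem_univ x⟩ hcont.continuousOn
  obtain ⟨h, hh⟩ : ∃ h, h = (g.gradNormSq u y0 + a) / u y0 ^ 2 + ε * u y0 ^ k := ⟨_, rfl⟩
  have hmaxM : ∀ z, (g.gradNormSq u z + a) / u z ^ 2 + ε * u z ^ k ≤ h := fun z => by
    rw [hh]; exact hy0 (Set.mem_univ z)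
  have hch : c < h := by
    refine lt_of_lt_of_le ?_ (hmaxM x)
    have h1 : c ≤ (g.gradNormSq u x + a) / u x ^ 2 := (le_div_iff₀ (pow_pos (hpos x) 2)).2 hx
    have h2 : 0 < ε * u x ^ k := mul_pos hεpos (pow_pos (hpos x) k)
    linarith
  -- passage to a chart around the maximum point
  set e := chartAt (Model n) y0
  have he : e ∈ IsManifold.maximalAtlas 𝓘(ℝ, Model n) ∞ M :=
    IsManifold.chart_mem_maximalAtlas y0
  have hy0s : y0 ∈ e.source := mem_chart_source _ y0
  set y := e y0
  have hy : y ∈ e.target := e.map_source hy0s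
  have hsy : e.symm y = y0 := e.left_inv hy0s
  have hnhds : ∀ᶠ z in nhds y, z ∈ e.target := e.open_target.mem_nhds hy
  have hmet := g.isMetricAt_comp he hy
  have hf : ∀ᶠ z in nhds y, ContDiffAt ℝ ∞ (u ∘ e.symm) z :=
    hnhds.mono fun z hz => hu.contDiffAt_comp_symm he hz
  have hfy : (u ∘ e.symm) y = u y0 := congrArg u hsy
  have hdim : (2 - m - n : ℝ) ≠ 0 := by intro h0; linarith
  have hLap : ∀ᶠ z in nhds y, (u ∘ e.symm) z * Coord.laplacian (g.comp e) (u ∘ e.symm) z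
      = N * Coord.normSqGrad (g.comp e) (u ∘ e.symm) z + lam - mu * (u ∘ e.symm) z ^ 2 := by
    filter_upwards [hnhds] with z hz
    have := hqe.mul_laplacian hdim hchar he hz
    simp only [g.gradNormSq_symm hu he hz] at this
    simp only [Function.comp] at this ⊢
    rw [this, hN]
    ring
  let ψ : ℝ → ℝ := fun s => a + ε * s ^ (k + 2) - h * s ^ 2
  have hψ : ContDiff ℝ ∞ ψ := by fun_prop
  have hψ1 : deriv ψ = fun s => ε * ((k + 2) * s ^ (k + 1)) - h * (2 * s) := by
    ext s
    simpa [ψ] using ((((hasDerivAt_pow (k + 2) s).const_mul ε).const_add a).fun_sub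
      ((hasDerivAt_pow 2 s).const_mul h)).deriv
  have hψ2 : deriv (deriv ψ) = fun s => ε * ((k + 2) * ((k + 1) * s ^ k)) - h * 2 := by
    rw [hψ1]
    ext s
    simpa using ((((hasDerivAt_pow (k + 1) s).const_mul ((k : ℝ) + 2)).const_mul ε).fun_sub
      (((hasDerivAt_id s).const_mul 2).const_mul h)).deriv
  have hΦ : ∀ z ∈ e.target, Coord.normSqGrad (g.comp e) (u ∘ e.symm) z + ψ ((u ∘ e.symm) z)
      = u (e.symm z) ^ 2 * ((g.gradNormSq u (e.symm z) + a) / u (e.symm z) ^ 2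
        + ε * u (e.symm z) ^ k - h) := by
    intro z hz
    have hne := (hpos (e.symm z)).ne'
    rw [← g.gradNormSq_symm hu he hz]
    simp only [ψ, Function.comp]
    field_simp
    ring
  have hΦy : Coord.normSqGrad (g.comp e) (u ∘ e.symm) y + ψ ((u ∘ e.symm) y) = 0 := by
    rw [hΦ y hy, hsy, ← hh, sub_self, mul_zero]
  have hmax : IsLocalMax (fun z => Coord.normSqGrad (g.comp e) (u ∘ e.symm) z
      + ψ ((u ∘ e.symm) z)) y := by
    filter_upwards [hnhds] with z hz
    rw [hΦy, hΦ z hz]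
    exact mul_nonpos_of_nonneg_of_nonpos (sq_nonneg _) (sub_nonpos.2 (hmaxM _))
  have hmain := hmet.laplacian_sq_le_of_isLocalMax hf (hpos _) (hqe e he y hy) hLap hψ hmax
  have hLapy := hLap.self_of_nhds
  rw [hψ2, hψ1] at hmain
  have hw := hmet.normSqGrad_nonneg (u ∘ e.symm)
  simp only [ψ] at hΦy
  rw [hfy] at hmain hLapy hΦy
  refine false_of_perturbed_max hn' hm hN rfl hmuc (hpos y0) hw
    (mul_pos hεpos (pow_pos (hpos y0) k)) hk (hεle y0) hch (a := a) ?_ ?_ ?_ ?_ hmain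
  · linear_combination hΦy
  · rw [hLapy, hlam]; ring
  · ring
  · ring
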